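/- For a prime power $q$ and an integer $m\ge 1$, let $Sp(2m,q)$ be the symplectic graph: its vertices are the one-dimensional subspaces of $\mathbb{F}_q^{2m}$, and two of them are adjacent if and only if they are not orthogonal with respect to the standard nondegenerate symplectic form on $\mathbb{F}_q^{2m}$. The energy $\|G\|_*$ of a finite graph $G$ is the sum of the absolute values of the eigenvalues (with multiplicity) of its adjacency matrix. Let $q$ be a prime power. (a) For every $n_0$ there exist integers $n>n_0$ and $k$ and a $k$-regular graph $G$ of order $n$, isomorphic to $Sp(2m,q)$ for some $m\ge 1$, such that $$k=\frac{q-1}{q}\,n+\frac1q\qquad\text{and}\qquad \|G\|_*=k+\sqrt{k(n-k)(n-1)}.$$ (b) For every $n_0$ there exist integers $n>n_0$ and $k$ and a $k$-regular graph $G$ of order $n$, isomorphic to the complement of $Sp(2m,q)$ for some $m\ge 1$, such that $$k=\frac{n}{q}-\frac{q+1}{q}\qquad\text{and}\qquad \|G\|_*>\sqrt{k(n-k)n}-n+k+1.$$ -/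

import Mathlib

/-- The symplectic form `v J wᵗ` on `F ^ (2m)`, where `J` is the standard block matrix
`[[0, -1], [1, 0]]`. -/
def sympForm {F : Type*} [Field F] {m : ℕ} (v w : Fin m ⊕ Fin m → F) : F :=
  v ⬝ᵥ (Matrix.J (Fin m) F).mulVec w

theorem sympForm_eq {F : Type*} [Field F] {m : ℕ} (v w : Fin m ⊕ Fin m → F) :
    sympForm v w = ∑ i, (v (Sum.inr i) * w (Sum.inl i) - v (Sum.inl i) * w (Sum.inr i)) := by
  simp [sympForm, Matrix.J, Matrix.mulVec, dotProduct, Fintype.sum_sum_type, Matrix.one_apply,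
    Finset.sum_sub_distrib]
  ring

theorem sympForm_self {F : Type*} [Field F] {m : ℕ} (v : Fin m ⊕ Fin m → F) :
    sympForm v v = 0 := by
  rw [sympForm_eq]
  exact Finset.sum_eq_zero fun i _ => by ring

theorem sympForm_swap {F : Type*} [Field F] {m : ℕ} (v w : Fin m ⊕ Fin m → F) :
    sympForm v w = - sympForm w v := by
  rw [sympForm_eq, sympForm_eq, ← Finset.sum_neg_distrib]
  exact Finset.sum_congr rfl fun i _ => by ring

/-- The symplectic graph `Sp(2m, F)`: its vertices are the one-dimensional subspaces of
`F ^ (2m)`, two of them being adjacent when they are not orthogonal with respect to the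
symplectic form. -/
def symplecticGraph (F : Type*) [Field F] (m : ℕ) :
    SimpleGraph (Projectivization F (Fin m ⊕ Fin m → F)) where
  Adj x y := sympForm x.rep y.rep ≠ 0
  symm := ⟨fun x y h => by rw [sympForm_swap]; exact neg_ne_zero.mpr h⟩
  loopless := ⟨fun x h => h (sympForm_self x.rep)⟩

/-- Adjacency in the symplectic graph does not depend on the chosen representatives. -/
theorem symplecticGraph_adj_mk {F : Type*} [Field F] {m : ℕ} (v w : Fin m ⊕ Fin m → F)
    (hv : v ≠ 0) (hw : w ≠ 0) :
    (symplecticGraph F m).Adj (Projectivization.mk F v hv) (Projectivization.mk F w hw) ↔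
      sympForm v w ≠ 0 := by
  obtain ⟨a, ha⟩ := Projectivization.exists_smul_eq_mk_rep F v hv
  obtain ⟨b, hb⟩ := Projectivization.exists_smul_eq_mk_rep F w hw
  have h : sympForm (a • v) (b • w) = (a : F) * (b : F) * sympForm v w := by
    rw [sympForm_eq, sympForm_eq, Finset.mul_sum]
    refine Finset.sum_congr rfl fun i _ => ?_
    simp only [Pi.smul_apply, Units.smul_def, smul_eq_mul]
    ring
  change sympForm _ _ ≠ 0 ↔ _
  rw [← ha, ← hb, h]
  simp

/-- The energy of a finite graph: the sum of the absolute values of the eigenvalues, counted with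
multiplicity, of its (real symmetric) adjacency matrix. -/
noncomputable def graphEnergy {V : Type*} [Fintype V] [DecidableEq V] (G : SimpleGraph V)
    [DecidableRel G.Adj] : ℝ :=
  ∑ i, |(G.isHermitian_adjMatrix ℝ).eigenvalues i|

open Finset

/-! ### Spectra and energies of strongly regular graphs -/

/-! Put `s = q^(m-1)`. Since `J` is invertible, independent vectors give independent functionals,
and counting shows that `Sp(2m,q)` is strongly regular with `k = q s²` and `l = μ = (q-1) s²`
(`symplecticGraph_isSRGWith`). On zero-sum vectors `A² = k - μ = s²`, so the spectrum lies in `{k,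
s, -s}` and that of the complement in `{n-k-1, s-1, -s-1}`. Multiplicities are never computed: on
three points `|x|` agrees with a quadratic polynomial, and the traces of `1`, `A`, `A²` are `n`,
`0`, `n` times the degree. This gives the energies `k + (n-1)s` and `n-k-1 + (n-1)s - k/s`. Part (a)
follows from `k(n-k) = s²(n-1)`; part (b) is an estimate after squaring. -/

theorem Matrix.IsHermitian.sum_eigenvalues_sq {n : Type*} [Fintype n] [DecidableEq n]
    {A : Matrix n n ℝ} (hA : A.IsHermitian) : ∑ i, hA.eigenvalues i ^ 2 = (A ^ 2).trace := by
  conv_rhs => rw [hA.spectral_theorem, ← map_pow, Unitary.conjStarAlgAut_apply,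
    Matrix.trace_mul_comm, ← mul_assoc]
  simp [Matrix.diagonal_pow, Matrix.trace_diagonal]

namespace SimpleGraph

variable {V : Type*} [Fintype V] [DecidableEq V] {G : SimpleGraph V} [DecidableRel G.Adj]

/-- The energy of a regular graph, once the absolute value agrees with a quadratic polynomial on
the spectrum. -/
theorem IsRegularOfDegree.graphEnergy_eq {d : ℕ} (h : G.IsRegularOfDegree d) (a b c : ℝ)
    (habs : ∀ i, |(G.isHermitian_adjMatrix ℝ).eigenvalues i| =
      a + b * (G.isHermitian_adjMatrix ℝ).eigenvalues i +
        c * (G.isHermitian_adjMatrix ℝ).eigenvalues i ^ 2) :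
    graphEnergy G = Fintype.card V * a + c * (Fintype.card V * d) := by
  have h1 : ∑ i, (G.isHermitian_adjMatrix ℝ).eigenvalues i = 0 := by
    have := (G.isHermitian_adjMatrix ℝ).trace_eq_sum_eigenvalues
    simpa using this.symm
  have h2 : ∑ i, (G.isHermitian_adjMatrix ℝ).eigenvalues i ^ 2 = Fintype.card V * d := by
    rw [Matrix.IsHermitian.sum_eigenvalues_sq, Matrix.trace, sq]
    simp only [Matrix.diag_apply, adjMatrix_mul_self_apply_self, h.degree_eq]
    simp
  rw [graphEnergy, sum_congr rfl fun i _ => habs i, sum_add_distrib, sum_add_distrib,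
    ← mul_sum, ← mul_sum, h1, h2]
  simp

/-- An eigenvalue of a regular graph is the degree, or it has an eigenvector with zero sum. -/
theorem IsRegularOfDegree.eigenvalues_eq_or {d : ℕ} (h : G.IsRegularOfDegree d) (i : V) :
    (G.isHermitian_adjMatrix ℝ).eigenvalues i = d ∨ ∃ v : V → ℝ, v ≠ 0 ∧ ∑ j, v j = 0 ∧
      (G.adjMatrix ℝ).mulVec v = (G.isHermitian_adjMatrix ℝ).eigenvalues i • v := by
  set hA := G.isHermitian_adjMatrix ℝ
  set v : V → ℝ := ⇑(hA.eigenvectorBasis i) with hv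
  have hev : (G.adjMatrix ℝ).mulVec v = hA.eigenvalues i • v := hA.mulVec_eigenvectorBasis i
  have hv0 : v ≠ 0 := fun h0 => hA.eigenvectorBasis.orthonormal.ne_zero i (by
    ext j
    exact congrFun h0 j)
  -- Evaluate `1ᵀ A v` in two ways: `1ᵀ A = d 1ᵀ`, and `A v` is a multiple of `v`.
  have hsum : (d : ℝ) * ∑ j, v j = hA.eigenvalues i * ∑ j, v j := by
    have h1 : (1 : V → ℝ) ⬝ᵥ (G.adjMatrix ℝ).mulVec v = d * ∑ j, v j := by
      rw [Matrix.dotProduct_mulVec]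
      have : Matrix.vecMul (1 : V → ℝ) (G.adjMatrix ℝ) = fun _ => (d : ℝ) := by
        ext j
        simp [h.degree_eq]
      rw [this]
      simp [dotProduct, mul_sum]
    rw [← h1, hev]
    simp [dotProduct, mul_sum]
  by_cases h0 : ∑ j, v j = 0
  · exact Or.inr ⟨v, hv0, h0, hev⟩
  · exact Or.inl (mul_right_cancel₀ h0 hsum).symm

/-- The all-ones matrix kills zero-sum vectors, so there the complement acts as `-1 - A`. -/
theorem adjMatrix_compl_mulVec {v : V → ℝ} (hsum : ∑ j, v j = 0) :
    (Gᶜ.adjMatrix ℝ).mulVec v = -v - (G.adjMatrix ℝ).mulVec v := by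
  have h : Gᶜ.adjMatrix ℝ = Matrix.of (fun _ _ => 1) - 1 - G.adjMatrix ℝ := by
    ext x y
    by_cases hxy : x = y
    · simp [hxy]
    · by_cases ha : G.Adj x y <;> simp [hxy, ha]
  have h0 : (Matrix.of fun _ _ : V => (1 : ℝ)).mulVec v = 0 := by
    ext x
    simp [Matrix.mulVec, dotProduct, hsum]
  rw [h, Matrix.sub_mulVec, Matrix.sub_mulVec, h0, Matrix.one_mulVec, zero_sub]

/-- The quadratic equation for the restricted eigenvalues of a strongly regular graph. -/
theorem IsSRGWith.eigenvalue_sq {n k l μ : ℕ} (h : G.IsSRGWith n k l μ) {v : V → ℝ} {a : ℝ}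
    (hv : v ≠ 0) (hsum : ∑ j, v j = 0) (hev : (G.adjMatrix ℝ).mulVec v = a • v) :
    a ^ 2 = k + l * a + μ * (-1 - a) := by
  have h1 : (G.adjMatrix ℝ ^ 2).mulVec v = a ^ 2 • v := by
    rw [sq, ← Matrix.mulVec_mulVec, hev, Matrix.mulVec_smul, hev, smul_smul, sq]
  rw [h.matrix_eq, Matrix.add_mulVec, Matrix.add_mulVec, Matrix.smul_mulVec, Matrix.smul_mulVec,
    Matrix.smul_mulVec, adjMatrix_compl_mulVec hsum, hev, Matrix.one_mulVec] at h1
  obtain ⟨x, hx⟩ := Function.ne_iff.1 hv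
  have h2 := congrFun h1 x
  simp only [Pi.add_apply, Pi.smul_apply, Pi.sub_apply, Pi.neg_apply, smul_eq_mul] at h2
  simp only [nsmul_eq_mul] at h2
  exact mul_right_cancel₀ hx (by linear_combination -h2)

/-- The energy of a strongly regular graph with `l = μ`. -/
theorem IsSRGWith.graphEnergy_eq {n k μ : ℕ} (h : G.IsSRGWith n k μ μ) {s : ℝ} (hs : 0 < s)
    (hk : (k : ℝ) = s ^ 2 + μ) (hkn : (k : ℝ) ^ 2 = s ^ 2 + μ * n) :
    graphEnergy G = k + (n - 1) * s := by
  have hks : 0 < (k : ℝ) + s := by positivity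
  -- The even quadratic `s + (x² - s²)/(k + s)` equals `|x|` at `x = s, -s, k`.
  rw [h.regular.graphEnergy_eq (s - s ^ 2 / (k + s)) 0 (1 / (k + s)), h.card]
  · field_simp
    linear_combination (n : ℝ) * hk - hkn
  · intro i
    rcases h.regular.eigenvalues_eq_or i with he | ⟨v, hv, hsum, hev⟩
    · rw [he, Nat.abs_cast]
      field_simp
      ring
    · have h2 := h.eigenvalue_sq hv hsum hev
      set a := (G.isHermitian_adjMatrix ℝ).eigenvalues i
      have h3 : a ^ 2 = s ^ 2 := by linear_combination h2 + hk
      rw [← abs_of_pos hs, (sq_eq_sq_iff_abs_eq_abs _ _).1 h3, h3, abs_of_pos hs]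
      ring

/-- The energy of the complement of a strongly regular graph with `l = μ`. -/
theorem IsSRGWith.graphEnergy_compl_eq {n k μ : ℕ} (h : G.IsSRGWith n k μ μ) {s : ℝ} (hs : 1 ≤ s)
    (hk : (k : ℝ) = s ^ 2 + μ) (hkn : (k : ℝ) ^ 2 = s ^ 2 + μ * n) (hlt : k < n) :
    graphEnergy Gᶜ = n - k - 1 + (n - 1) * s - k / s := by
  have hd : ((n - k - 1 : ℕ) : ℝ) = n - k - 1 := by
    rw [Nat.sub_sub, Nat.cast_sub (by lia)]
    push_cast
    ring
  have hlt' : (k : ℝ) + 1 ≤ n := by exact_mod_cast hlt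
  have hs0 : 0 < s := by linarith
  set t : ℝ := n - k with ht
  have hts : 0 < t + s := by linarith
  -- With `y = x + 1`, the line `s - y/s` equals `|x|` at `y = s, -s`. Adding `c (y² - s²)` keeps
  -- these values, and `c` is chosen to give `t - 1` at `y = t`, the degree of the complement.
  set c : ℝ := (s + 1) / (s * (t + s)) with hc
  rw [h.compl_is_regular.graphEnergy_eq (s - 1 / s + c * (1 - s ^ 2)) (-1 / s + 2 * c) c, h.card,
    hd]
  · have hkt : (k : ℝ) * t + s ^ 2 = n * s ^ 2 := by linear_combination n * hk - hkn + k * ht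
    rw [hc]
    field_simp
    linear_combination (1 + s) * hkt
  · intro i
    rcases h.compl_is_regular.eigenvalues_eq_or i with he | ⟨v, hv, hsum, hev⟩
    · rw [he, Nat.abs_cast, hd, hc]
      field_simp
      ring
    · set a := (Gᶜ.isHermitian_adjMatrix ℝ).eigenvalues i
      have hG : (G.adjMatrix ℝ).mulVec v = (-1 - a) • v := by
        rw [adjMatrix_compl_mulVec hsum] at hev
        rw [sub_smul, ← hev]
        simp
      have h2 := h.eigenvalue_sq hv hsum hG
      have h3 : (a + 1 - s) * (a + 1 + s) = 0 := by linear_combination h2 + hk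
      rcases mul_eq_zero.1 h3 with h4 | h4
      · obtain rfl : s = a + 1 := by linarith
        rw [abs_of_nonneg (by linarith)]
        field_simp
        ring
      · obtain ha : a = -1 - s := by linarith
        rw [ha, abs_of_neg (by linarith)]
        field_simp
        ring

end SimpleGraph

theorem SimpleGraph.IsSRGWith.of_iso {V W : Type*} [Fintype V] [Fintype W]
    {G : SimpleGraph V} [DecidableRel G.Adj] {H : SimpleGraph W} [DecidableRel H.Adj]
    {n k l μ : ℕ} (h : H.IsSRGWith n k l μ) (e : G ≃g H) : G.IsSRGWith n k l μ := by
  have key (v w) : Fintype.card (G.commonNeighbors v w) =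
      Fintype.card (H.commonNeighbors (e v) (e w)) :=
    Fintype.card_congr (e.toEquiv.subtypeEquiv fun x => by
      simp [mem_commonNeighbors, ← e.map_adj_iff])
  refine ⟨(Fintype.card_congr e.toEquiv).trans h.card, fun v => ?_, fun v w hvw => ?_,
    fun v w hne hvw => ?_⟩
  · rw [← h.regular.degree_eq (e v), e.degree_eq]
  · rw [key, h.of_adj _ _ (e.map_adj_iff.2 hvw)]
  · rw [key, h.of_not_adj (e.injective.ne hne) (by rwa [e.map_adj_iff])]

/-! ### Counting in the symplectic graph -/

/-- A linear section of `f` splits `V` as `W × ker f`. -/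
theorem LinearMap.natCard_subtype_comp {K V W : Type*} [Field K] [AddCommGroup V] [Module K V]
    [AddCommGroup W] [Module K W] (f : V →ₗ[K] W) (hf : Function.Surjective f) (P : W → Prop) :
    Nat.card {v // P (f v)} = Nat.card {w // P w} * Nat.card (LinearMap.ker f) := by
  obtain ⟨g, hg⟩ := f.exists_rightInverse_of_surjective (LinearMap.range_eq_top.2 hf)
  have hg' (w : W) : f (g w) = w := LinearMap.congr_fun hg w
  rw [← Nat.card_prod]
  exact Nat.card_congr
    { toFun := fun v => (⟨f v, v.2⟩, ⟨v - g (f v), by simp [hg']⟩)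
      invFun := fun p => ⟨g p.1 + p.2, by
        have := p.2.2
        rw [LinearMap.mem_ker] at this
        simpa [hg', this] using p.1.2⟩
      left_inv := fun v => by simp
      right_inv := fun p => by
        have := p.2.2
        rw [LinearMap.mem_ker] at this
        ext <;> simp [hg', this] }

/-- Multiplying by the invertible `J` preserves the rank, which is the number of rows. -/
theorem sympForm_surjective {F : Type*} [Field F] {m : ℕ} {ι : Type*} [Fintype ι]
    (w : ι → Fin m ⊕ Fin m → F) (hw : LinearIndependent F w) :
    Function.Surjective
      ((Matrix.of w * Matrix.J (Fin m) F).mulVecLin) := by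
  rw [← LinearMap.range_eq_top]
  apply Submodule.eq_top_of_finrank_eq
  rw [← Matrix.rank, Matrix.rank_mul_eq_left_of_isUnit_det _ _ (Matrix.isUnit_det_J _ _),
    LinearIndependent.rank_matrix (M := Matrix.of w) hw]
  simp

theorem natCard_sympForm_ne_zero {F : Type*} [Field F] [Finite F] {m : ℕ} {ι : Type*} [Fintype ι]
    (w : ι → Fin m ⊕ Fin m → F) (hw : LinearIndependent F w) :
    Nat.card F ^ Fintype.card ι * Nat.card {z // ∀ i, sympForm (w i) z ≠ 0} =
      (Nat.card F - 1) ^ Fintype.card ι * Nat.card F ^ (2 * m) := by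
  set f := (Matrix.of w * Matrix.J (Fin m) F).mulVecLin
  have hf (z) (i) : f z i = sympForm (w i) z := by
    simp [f, sympForm, Matrix.mulVec]
  -- The trivial predicate counts the whole space, which determines the size of the kernel.
  have h1 := f.natCard_subtype_comp (sympForm_surjective w hw) fun _ => True
  have h2 := f.natCard_subtype_comp (sympForm_surjective w hw) fun y => ∀ i, y i ≠ 0
  simp only [hf] at h2
  have h3 : Nat.card {y : ι → F // ∀ i, y i ≠ 0} = (Nat.card F - 1) ^ Fintype.card ι := by
    rw [Nat.card_congr (Equiv.subtypePiEquivPi (p := fun _ (a : F) => a ≠ 0)), Nat.card_pi]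
    simp [← Nat.card_units, Nat.card_congr unitsEquivNeZero.symm]
  have h4 : Nat.card F ^ (2 * m) = Nat.card F ^ Fintype.card ι * Nat.card (LinearMap.ker f) := by
    simpa [Nat.card_fun, two_mul] using h1
  rw [h2, h3, h4]
  ring

/-- Each nonzero vector is a unique unit multiple of the chosen representative of its line. -/
theorem Projectivization.natCard_units_mul {K V : Type*} [Field K] [AddCommGroup V] [Module K V]
    (P : V → Prop) (h0 : ¬ P 0) (hP : ∀ (u : Kˣ) v, P (u • v) ↔ P v) :
    Nat.card {p : Projectivization K V // P p.rep} * Nat.card Kˣ = Nat.card {v // P v} := by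
  rw [← Nat.card_prod]
  refine Nat.card_congr (Equiv.ofBijective
    (fun x : {p : Projectivization K V // P p.rep} × Kˣ =>
      (⟨x.2 • x.1.1.rep, (hP _ _).2 x.1.2⟩ : {v // P v})) ⟨?_, ?_⟩)
  · rintro ⟨⟨p, hp⟩, u⟩ ⟨⟨p', hp'⟩, u'⟩ h
    have h : u • p.rep = u' • p'.rep := congrArg Subtype.val h
    have hpp : p = p' := by
      rw [← p.mk_rep, ← p'.mk_rep, Projectivization.mk_eq_mk_iff]
      exact ⟨u⁻¹ * u', by rw [mul_smul, ← h, inv_smul_smul]⟩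
    subst hpp
    have : (u : K) = u' := smul_left_injective K p.rep_nonzero h
    simp [Units.ext this]
  · rintro ⟨v, hv⟩
    have hv0 : v ≠ 0 := fun h => h0 (h ▸ hv)
    obtain ⟨a, ha⟩ := Projectivization.exists_smul_eq_mk_rep K v hv0
    exact ⟨⟨⟨Projectivization.mk K v hv0, by rw [← ha]; exact (hP _ _).2 hv⟩, a⁻¹⟩,
      Subtype.ext (by simp [← ha])⟩

theorem sympForm_units_smul_right {F : Type*} [Field F] {m : ℕ} (u : Fˣ)
    (v w : Fin m ⊕ Fin m → F) : sympForm v (u • w) = u * sympForm v w := by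
  simp [sympForm, Units.smul_def, Matrix.mulVec_smul]

theorem natCard_points_sympForm_ne_zero {F : Type*} [Field F] [Finite F] {m : ℕ} {ι : Type*}
    [Fintype ι] [Nonempty ι] (w : ι → Fin m ⊕ Fin m → F) (hw : LinearIndependent F w) :
    Nat.card F ^ Fintype.card ι * (Nat.card {p : Projectivization F (Fin m ⊕ Fin m → F) //
        ∀ i, sympForm (w i) p.rep ≠ 0} * (Nat.card F - 1)) =
      (Nat.card F - 1) ^ Fintype.card ι * Nat.card F ^ (2 * m) := by
  rw [← natCard_sympForm_ne_zero w hw, ← Projectivization.natCard_units_mul (K := F)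
      fun v => ∀ i, sympForm (w i) v ≠ 0,
    Nat.card_units]
  · simp [sympForm]
  · simp [sympForm_units_smul_right]

open Classical in
theorem symplecticGraph_isSRGWith {F : Type*} [Field F] [Finite F] (m : ℕ)
    [Fintype (Projectivization F (Fin (m + 1) ⊕ Fin (m + 1) → F))] :
    (symplecticGraph F (m + 1)).IsSRGWith
      (Fintype.card (Projectivization F (Fin (m + 1) ⊕ Fin (m + 1) → F)))
      (Nat.card F ^ (2 * m + 1)) ((Nat.card F - 1) * Nat.card F ^ (2 * m))
      ((Nat.card F - 1) * Nat.card F ^ (2 * m)) := by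
  have hq : 1 < Nat.card F := Finite.one_lt_card
  have hq' : 0 < Nat.card F - 1 := by lia
  -- Distinct points have independent representatives, so the count ignores adjacency; hence `l =
  -- μ`.
  have key (x y) (hxy : x ≠ y) : Fintype.card ((symplecticGraph F (m + 1)).commonNeighbors x y) =
      (Nat.card F - 1) * Nat.card F ^ (2 * m) := by
    have h := natCard_points_sympForm_ne_zero _ (Projectivization.independent_iff.1
      ((Projectivization.independent_pair_iff_ne x y).2 hxy))
    have e : Nat.card {p : Projectivization F (Fin (m + 1) ⊕ Fin (m + 1) → F) //
        ∀ i, sympForm ((Projectivization.rep ∘ ![x, y]) i) p.rep ≠ 0} =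
        Fintype.card ((symplecticGraph F (m + 1)).commonNeighbors x y) := by
      rw [Nat.card_eq_fintype_card]
      refine Fintype.card_congr (Equiv.subtypeEquivRight fun p => ?_)
      simp [Fin.forall_fin_two, SimpleGraph.mem_commonNeighbors, symplecticGraph]
    rw [e, Fintype.card_fin] at h
    have h' : (Nat.card F ^ 2 * (Nat.card F - 1)) *
        Fintype.card ((symplecticGraph F (m + 1)).commonNeighbors x y) =
        (Nat.card F ^ 2 * (Nat.card F - 1)) * ((Nat.card F - 1) * Nat.card F ^ (2 * m)) := by
      linear_combination h
    exact Nat.eq_of_mul_eq_mul_left (by positivity) h'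
  refine ⟨rfl, fun x => ?_, fun x y h => key x y h.ne, fun x y h _ => key x y h⟩
  have h := natCard_points_sympForm_ne_zero (fun _ : Unit => x.rep)
    (LinearIndependent.of_subsingleton () x.rep_nonzero)
  have e : Nat.card {p : Projectivization F (Fin (m + 1) ⊕ Fin (m + 1) → F) //
      ∀ _ : Unit, sympForm x.rep p.rep ≠ 0} = (symplecticGraph F (m + 1)).degree x := by
    rw [← SimpleGraph.card_neighborSet_eq_degree, Nat.card_eq_fintype_card]
    refine Fintype.card_congr (Equiv.subtypeEquivRight fun p => ?_)
    simp [symplecticGraph]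
  rw [e, Fintype.card_unit] at h
  have h' : (Nat.card F * (Nat.card F - 1)) * (symplecticGraph F (m + 1)).degree x =
      (Nat.card F * (Nat.card F - 1)) * Nat.card F ^ (2 * m + 1) := by
    linear_combination h
  exact Nat.eq_of_mul_eq_mul_left (by positivity) h'

/-! ### The two families -/

theorem exists_field_natCard_eq {q : ℕ} (hq : IsPrimePow q) :
    ∃ (F : Type) (_ : Field F), Nat.card F = q := by
  obtain ⟨p, r, hp, hr, rfl⟩ := (isPrimePow_nat_iff q).1 hq
  have : Fact p.Prime := ⟨hp⟩
  exact ⟨GaloisField p r, inferInstance, GaloisField.card p r hr.ne'⟩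

/-- A copy of the symplectic graph on `Fin n`, with its strongly regular parameters. -/
theorem exists_symplecticGraph_copy (F : Type) [Field F] [Finite F] (m : ℕ) :
    ∃ (n : ℕ) (G : SimpleGraph (Fin n)) (_ : DecidableRel G.Adj),
      2 * m < n ∧ n * (Nat.card F - 1) + 1 = Nat.card F ^ (2 * m + 2) ∧
      Nonempty (G ≃g symplecticGraph F (m + 1)) ∧
      G.IsSRGWith n (Nat.card F ^ (2 * m + 1)) ((Nat.card F - 1) * Nat.card F ^ (2 * m))
        ((Nat.card F - 1) * Nat.card F ^ (2 * m)) := by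
  classical
  let P := Projectivization F (Fin (m + 1) ⊕ Fin (m + 1) → F)
  let _ : Fintype P := Fintype.ofFinite P
  let e := Fintype.equivFin P
  let i : (symplecticGraph F (m + 1)).comap e.symm ≃g symplecticGraph F (m + 1) :=
    SimpleGraph.Iso.comap e.symm _
  refine ⟨Fintype.card P, (symplecticGraph F (m + 1)).comap e.symm, inferInstance, ?_, ?_, ⟨i⟩,
    (symplecticGraph_isSRGWith m).of_iso i⟩
  · have h := Projectivization.card_of_finrank F (Fin (m + 1) ⊕ Fin (m + 1) → F)
      (n := 2 * m + 2) (by simp; ring)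
    rw [← Nat.card_eq_fintype_card, h]
    have : ∑ i ∈ range (2 * m + 2), 1 ≤ ∑ i ∈ range (2 * m + 2), Nat.card F ^ i :=
      sum_le_sum fun i _ => Nat.one_le_pow _ _ Nat.card_pos
    simp at this
    lia
  · have h := Projectivization.card' F (Fin (m + 1) ⊕ Fin (m + 1) → F)
    rw [← Nat.card_eq_fintype_card, ← h]
    simp [Nat.card_fun]
    ring

theorem SimpleGraph.nonempty_compl_iso {V W : Type*} {G : SimpleGraph V} {H : SimpleGraph W}
    (e : G ≃g H) : Nonempty (Gᶜ ≃g Hᶜ) :=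
  ⟨⟨e.toEquiv, by
    intro a b
    simp [SimpleGraph.compl_adj, e.map_adj_iff]⟩⟩

theorem mainTheorem8 (q : ℕ) (hq : IsPrimePow q) :
    (∀ n₀ : ℕ, ∃ (n k : ℕ) (G : SimpleGraph (Fin n)) (_ : DecidableRel G.Adj),
      n₀ < n ∧
      (∃ (m : ℕ) (F : Type) (_ : Field F),
        1 ≤ m ∧ Nat.card F = q ∧ Nonempty (G ≃g symplecticGraph F m)) ∧
      G.IsRegularOfDegree k ∧
      (k : ℝ) = ((q : ℝ) - 1) / q * n + 1 / q ∧
      graphEnergy G = k + √((k : ℝ) * ((n : ℝ) - k) * ((n : ℝ) - 1))) ∧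
    (∀ n₀ : ℕ, ∃ (n k : ℕ) (G : SimpleGraph (Fin n)) (_ : DecidableRel G.Adj),
      n₀ < n ∧
      (∃ (m : ℕ) (F : Type) (_ : Field F),
        1 ≤ m ∧ Nat.card F = q ∧ Nonempty (G ≃g (symplecticGraph F m)ᶜ)) ∧
      G.IsRegularOfDegree k ∧
      (k : ℝ) = (n : ℝ) / q - ((q : ℝ) + 1) / q ∧
      graphEnergy G > √((k : ℝ) * ((n : ℝ) - k) * n) - n + k + 1) := by
  obtain ⟨F, _, rfl⟩ := exists_field_natCard_eq hq
  have : Finite F := Nat.finite_of_card_ne_zero hq.ne_zero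
  have hq2 : 2 ≤ Nat.card F := hq.two_le
  have hq2' : (2 : ℝ) ≤ Nat.card F := by exact_mod_cast hq2
  have hpred : ((Nat.card F - 1 : ℕ) : ℝ) = (Nat.card F : ℝ) - 1 := by
    rw [Nat.cast_sub (by lia), Nat.cast_one]
  refine ⟨fun n₀ => ?_, fun n₀ => ?_⟩ <;>
    -- Taking `n₀ + 1` makes `n > n₀` and also `s = q^(n₀+1) ≥ q`, which the estimate in (b) needs.
    obtain ⟨n, G, _, hn, hcard, ⟨i⟩, hG⟩ := exists_symplecticGraph_copy F (n₀ + 1) <;>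
    generalize hqF : Nat.card F = q at * <;>
    have hcard' : (n : ℝ) * (q - 1) + 1 = q ^ (2 * (n₀ + 1) + 2) := by
      rw [← hpred]
      exact_mod_cast hcard
  all_goals
    obtain ⟨s, hs⟩ : ∃ s : ℝ, s = (q : ℝ) ^ (n₀ + 1) := ⟨_, rfl⟩
    have hs1 : (q : ℝ) ≤ s := hs ▸ le_self_pow₀ (by linarith) (by lia)
    have hk : ((q ^ (2 * (n₀ + 1) + 1) : ℕ) : ℝ) = q * s ^ 2 := by rw [hs]; push_cast; ring
    have hμ : (((q - 1) * q ^ (2 * (n₀ + 1)) : ℕ) : ℝ) = (q - 1) * s ^ 2 := by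
      rw [Nat.cast_mul, hpred, hs]; push_cast; ring
    have hns : (n : ℝ) * (q - 1) + 1 = q ^ 2 * s ^ 2 := by rw [hcard', hs]; ring
    have hk1 : ((q ^ (2 * (n₀ + 1) + 1) : ℕ) : ℝ) =
      s ^ 2 + (((q - 1) * q ^ (2 * (n₀ + 1)) : ℕ) : ℝ) := by rw [hk, hμ]; ring
    -- This is `k(k - l - 1) = (n - k - 1)μ` with `l = μ` and `k = s² + μ`.
    have hk2 : ((q ^ (2 * (n₀ + 1) + 1) : ℕ) : ℝ) ^ 2 =
      s ^ 2 + (((q - 1) * q ^ (2 * (n₀ + 1)) : ℕ) : ℝ) * n := by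
      rw [hk, hμ]
      linear_combination (-s ^ 2) * hns
  · refine ⟨n, _, G, inferInstance, by lia, ⟨_, F, inferInstance, by lia, hqF, ⟨i⟩⟩, hG.regular,
      ?_, ?_⟩
    · rw [hk]
      field_simp
      linear_combination -hns
    · have hn1 : (1 : ℝ) ≤ n := by exact_mod_cast (by lia : 1 ≤ n)
      rw [hG.graphEnergy_eq (by linarith) hk1 hk2, hk]
      have hsq : (q : ℝ) * s ^ 2 * (n - q * s ^ 2) * (n - 1) = ((n - 1) * s) ^ 2 := by
        linear_combination (n - 1 : ℝ) * s ^ 2 * hns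
      rw [hsq, Real.sqrt_sq (mul_nonneg (by linarith) (by linarith))]
  · have hN : (q : ℝ) * s ^ 2 + q ≤ n - 1 := by
      have h1 : (q : ℝ) * q ≤ q * s ^ 2 := by
        gcongr
        nlinarith
      have h2 : ((q : ℝ) - 1) * (q * s ^ 2 + q) ≤ (q - 1) * (n - 1) := by linarith
      exact le_of_mul_le_mul_left h2 (by linarith)
    have hkn : q ^ (2 * (n₀ + 1) + 1) < n := by
      have : ((q ^ (2 * (n₀ + 1) + 1) : ℕ) : ℝ) < n := by rw [hk]; linarith
      exact_mod_cast this
    have hd : ((n - q ^ (2 * (n₀ + 1) + 1) - 1 : ℕ) : ℝ) = n - q * s ^ 2 - 1 := by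
      rw [Nat.sub_sub, Nat.cast_sub (by lia), Nat.cast_add, hk, Nat.cast_one]
      ring
    refine ⟨n, _, Gᶜ, inferInstance, by lia, ⟨_, F, inferInstance, by lia, hqF,
      SimpleGraph.nonempty_compl_iso i⟩, hG.compl_is_regular, ?_, ?_⟩
    · rw [hd]
      field_simp
      linear_combination hns
    · rw [hG.graphEnergy_compl_eq (by linarith) hk1 hk2 hkn, hd, hk]
      have hdiv : (q : ℝ) * s ^ 2 / s = q * s := by field_simp
      have hsqrt : √((n - q * s ^ 2 - 1) * (n - (n - q * s ^ 2 - 1)) * n : ℝ) <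
          (n - 1) * (s + 1) - q * s := by
        have hs2 : 2 ≤ s := hq2'.trans hs1
        have hkn' : (q : ℝ) * (n - q * s ^ 2) = n - 1 := by linear_combination hns
        -- By `hkn'`, the difference of the squares is `2s(n-1)² - 2qs(n-1) - (n-1)(s²+1) + q²s² +
        -- 2qs²`. By `hN` the first two terms leave at least `2qs³(n-1)`, which absorbs the third;
        -- the last two make the inequality strict.
        have h1 : (n - 1) * s * (q * s ^ 2) ≤ (n - 1) * s * (n - 1 - q) :=
          mul_le_mul_of_nonneg_left (by linarith) (by nlinarith)
        have h2 : (n - 1) * (s ^ 2 + 1) ≤ (n - 1) * (2 * q * s ^ 3) :=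
          mul_le_mul_of_nonneg_left (by nlinarith [sq_nonneg s, pow_pos (by linarith : 0 < s) 3])
            (by nlinarith)
        have h3 : 0 < (q : ℝ) ^ 2 * s ^ 2 + 2 * q * s ^ 2 := by positivity
        rw [Real.sqrt_lt' (by nlinarith)]
        linear_combination 2 * h1 + h2 + h3 + s ^ 2 * n * hkn'
      rw [hdiv]
      linarith
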